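/- Let $n\ge 2$, $\sigma>0$, and let $\mu$ be a finite complex Borel measure on $\mathbb{R}^n$ with $\mu(\mathbb{R}^n)=1$ whose Fourier transform $\widehat\mu(\xi)=\int_{\mathbb{R}^n}e^{-i\xi\cdot x}\,d\mu(x)$ satisfies, for some constants $c,C>0$, $$c\min\{1,|\xi|^{2\sigma}\}\le|1-\widehat\mu(\xi)|\le C\min\{1,|\xi|^{2\sigma}\}\qquad(\xi\in\mathbb{R}^n).$$ Let $\mathbb{T}^n=\mathbb{R}^n/\mathbb{Z}^n$ with its Haar probability measure, and let $\widehat f(k)=\int_{\mathbb{T}^n}f(x)e^{-2\pi i k\cdot x}\,dx$, $k\in\mathbb{Z}^n$, denote the Fourier coefficients of $f$. Let $1\le p\le2$, let $p'$ be the conjugate exponent ($p'=\infty$ if $p=1$), and let $f\in L^p(\mathbb{T}^n)$. For $t>0$ let $M_\mu^tf\in L^p(\mathbb{T}^n)$ be the function with Fourier series $$M_\mu^tf\sim\sum_{k\in\mathbb{Z}^n}\widehat\mu(tk)\,\widehat f(k)\,e^{2\pi i k\cdot x}$$ (the transference of $\mu$ to the torus; such a function exists and is unique in $L^p(\mathbb{T}^n)$).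 (1) If $\|M_\mu^tf-f\|_{L^p(\mathbb{T}^n)}=O(t^\alpha)$ as $t\to0^+$ for some $0<\alpha\le2\sigma$, then $\sum_{k\in\mathbb{Z}^n}|\widehat f(k)|^\beta$ converges for every real $\beta$ with $$\frac{np}{np+\alpha p-n}<\beta\le p'.$$ (2) If $2\sigma>\frac np$ and $\|M_\mu^tf-f\|_{L^p(\mathbb{T}^n)}=O(t^\alpha)$ as $t\to0^+$ for some $\alpha>\frac np$, then $\sum_{k\in\mathbb{Z}^n}|\widehat f(k)|$ converges, and the Fourier series of $f$ converges absolutely and uniformly on $\mathbb{T}^n$, to a continuous function that equals $f$ almost everywhere. -/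

import Mathlib

open MeasureTheory Filter Topology Asymptotics
open scoped ENNReal

namespace TorusMultiplier

/-- Haar probability measure on the torus `𝕋ⁿ = ℝⁿ / ℤⁿ`, the one used by
`UnitAddTorus.mFourierCoeff`. -/
noncomputable abbrev torusMeasure (n : ℕ) : Measure (UnitAddTorus (Fin n)) :=
  Measure.pi fun _ => AddCircle.haarAddCircle

/-- The space `L^p(𝕋ⁿ)` of complex-valued functions. -/
abbrev LpTorus (n : ℕ) (p : ℝ≥0∞) : Type :=
  Lp ℂ p (torusMeasure n)

/-- The Fourier transform `μ̂(ξ) = ∫ e^{-i ξ·x} dμ(x)` of a finite complex Borel measure on `ℝⁿ`. -/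
noncomputable def fourierStieltjes {n : ℕ} (μ : ComplexMeasure (EuclideanSpace ℝ (Fin n)))
    (ξ : EuclideanSpace ℝ (Fin n)) : ℂ :=
  VectorMeasure.integral μ (fun x => Complex.exp (-(Complex.I * ((inner ℝ ξ x : ℝ) : ℂ))))
    (ContinuousLinearMap.mul ℝ ℂ)

/-- The class `𝒦_σ`: finite (complex) Borel measures `μ` on `ℝⁿ` of total mass one with
`|1 - μ̂(ξ)| ≍ min {1, |ξ|^{2σ}}`, for `σ > 0`. -/
def ClassK {n : ℕ} (σ : ℝ) (μ : ComplexMeasure (EuclideanSpace ℝ (Fin n))) : Prop :=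
  0 < σ ∧ μ Set.univ = 1 ∧
    ∃ c C : ℝ, 0 < c ∧ 0 < C ∧ ∀ ξ : EuclideanSpace ℝ (Fin n),
      c * min 1 (‖ξ‖ ^ (2 * σ)) ≤ ‖1 - fourierStieltjes μ ξ‖ ∧
        ‖1 - fourierStieltjes μ ξ‖ ≤ C * min 1 (‖ξ‖ ^ (2 * σ))

/-- A lattice point `k ∈ ℤⁿ` as a vector of `ℝⁿ`. -/
noncomputable def latticePoint {n : ℕ} (k : Fin n → ℤ) : EuclideanSpace ℝ (Fin n) :=
  WithLp.toLp 2 fun i => (k i : ℝ)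

/-- `g` has the Fourier series `∑ₖ μ̂(t k) f̂(k) e_k`, where `e_k(x) = e^{2π i k·x}`. -/
def IsTransferredMean {n : ℕ} (μ : ComplexMeasure (EuclideanSpace ℝ (Fin n))) (t : ℝ)
    (f g : UnitAddTorus (Fin n) → ℂ) : Prop :=
  ∀ k : Fin n → ℤ, UnitAddTorus.mFourierCoeff g k =
    fourierStieltjes μ (t • latticePoint k) * UnitAddTorus.mFourierCoeff f k

/-! ### The multiplier operator on `L^p(𝕋ⁿ)` is well defined -/

theorem isFiniteMeasure_variation {X : Type*} [MeasurableSpace X] (μ : ComplexMeasure X) :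
    IsFiniteMeasure μ.variation := by
  let ν : Measure X := (ComplexMeasure.re μ).totalVariation + (ComplexMeasure.im μ).totalVariation
  refine isFiniteMeasure_of_le ν (VectorMeasure.variation_le_of_forall_enorm_le fun E _ => ?_)
  have h1 := SignedMeasure.enorm_le_totalVariation (ComplexMeasure.re μ) E
  have h2 := SignedMeasure.enorm_le_totalVariation (ComplexMeasure.im μ) E
  have h3 : μ E = ((ComplexMeasure.re μ E : ℝ) : ℂ) +
      ((ComplexMeasure.im μ E : ℝ) : ℂ) * Complex.I := (Complex.re_add_im (μ E)).symm
  rw [h3, Measure.add_apply]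
  refine (enorm_add_le _ _).trans (add_le_add ?_ ?_)
  · refine le_trans (le_of_eq ?_) h1
    rw [← ofReal_norm, ← ofReal_norm]; simp
  · refine le_trans (le_of_eq ?_) h2
    rw [← ofReal_norm, ← ofReal_norm]; simp

/-- A continuous linear map commutes with the integral against a vector measure. -/
theorem map_integral {X E F G E' G' : Type*} [MeasurableSpace X]
    [NormedAddCommGroup E] [NormedSpace ℝ E] [NormedAddCommGroup F] [NormedSpace ℝ F]
    [NormedAddCommGroup G] [NormedSpace ℝ G] [CompleteSpace G]
    [NormedAddCommGroup E'] [NormedSpace ℝ E']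
    [NormedAddCommGroup G'] [NormedSpace ℝ G'] [CompleteSpace G']
    (μ : VectorMeasure X F) [IsFiniteMeasure μ.variation]
    (B : E →L[ℝ] F →L[ℝ] G) (B' : E' →L[ℝ] F →L[ℝ] G') (L : G →L[ℝ] G') (L' : E →L[ℝ] E')
    (hL : ∀ e v, L (B e v) = B' (L' e) v) {f : X → E} (hf : Integrable f μ.variation) :
    L (VectorMeasure.integral μ f B) = VectorMeasure.integral μ (fun x => L' (f x)) B' := by
  refine Integrable.induction
    (P := fun f => L (VectorMeasure.integral μ f B) =
      VectorMeasure.integral μ (fun x => L' (f x)) B') ?_ ?_ ?_ ?_ hf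
  · intro c s hs _
    have h : (fun x => L' (s.indicator (fun _ => c) x)) = s.indicator fun _ => L' c := by
      ext x
      by_cases hx : x ∈ s <;> simp [hx]
    rw [h, VectorMeasure.integral_indicator_const c hs, VectorMeasure.integral_indicator_const _ hs]
    exact hL _ _
  · intro f g _ hf hg h1 h2
    have h : (fun x => L' ((f + g) x)) = fun x => L' (f x) + L' (g x) := by
      ext x
      simp
    rw [h, VectorMeasure.integral_fun_add (L'.integrable_comp hf) (L'.integrable_comp hg),
      VectorMeasure.integral_add hf hg, map_add, h1, h2]
  · have h : ∀ f : X →₁[μ.variation] E, VectorMeasure.integral μ (fun x => L' (f x)) B' =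
        VectorMeasure.integral μ (L'.compLp f) B' := fun f =>
      VectorMeasure.integral_congr_ae (EventuallyEq.symm (L'.coeFn_compLp f))
    simp only [h]
    refine isClosed_eq (L.continuous.comp VectorMeasure.continuous_integral) ?_
    exact VectorMeasure.continuous_integral.comp (L'.compLpL 1 μ.variation).continuous
  · intro f g hfg _ h
    rw [← VectorMeasure.integral_congr_ae hfg, h]
    exact VectorMeasure.integral_congr_ae (hfg.fun_comp L')

theorem mFourierCoeff_eq {n : ℕ} (f : UnitAddTorus (Fin n) → ℂ) (k : Fin n → ℤ) :
    UnitAddTorus.mFourierCoeff f k =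
      ∫ x, UnitAddTorus.mFourier (-k) x • f x ∂torusMeasure n := rfl

theorem norm_mFourier_apply {n : ℕ} (k : Fin n → ℤ) (x : UnitAddTorus (Fin n)) :
    ‖UnitAddTorus.mFourier k x‖ = 1 := by
  simp only [UnitAddTorus.mFourier, ContinuousMap.coe_mk, fourier_apply, norm_prod, Circle.norm_coe,
    Finset.prod_const_one]

theorem mFourier_apply_add {n : ℕ} (k : Fin n → ℤ) (x y : UnitAddTorus (Fin n)) :
    UnitAddTorus.mFourier k (x + y) =
      UnitAddTorus.mFourier k x * UnitAddTorus.mFourier k y := by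
  simp [UnitAddTorus.mFourier, fourier_apply, AddCircle.toCircle_add, Finset.prod_mul_distrib]

theorem integrable_mFourier_smul {n : ℕ} {f : UnitAddTorus (Fin n) → ℂ}
    (hf : Integrable f (torusMeasure n)) (k : Fin n → ℤ) :
    Integrable (fun x => UnitAddTorus.mFourier k x • f x) (torusMeasure n) := by
  refine Integrable.bdd_smul (φ := ⇑(UnitAddTorus.mFourier k)) hf 1 ?_ ?_
  · exact (UnitAddTorus.mFourier k).continuous.aestronglyMeasurable
  · exact Eventually.of_forall fun x => (norm_mFourier_apply k x).le

theorem integrable_LpTorus {n : ℕ} {p : ℝ≥0∞} [hp : Fact (1 ≤ p)] (f : LpTorus n p) :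
    Integrable f (torusMeasure n) :=
  memLp_one_iff_integrable.1 ((Lp.memLp f).mono_exponent hp.out)

/-- The `k`-th Fourier coefficient as a continuous linear functional on `L^p(𝕋ⁿ)`. -/
noncomputable def coeffCLM (n : ℕ) (p : ℝ≥0∞) [hp : Fact (1 ≤ p)] (k : Fin n → ℤ) :
    LpTorus n p →L[ℝ] ℂ :=
  LinearMap.mkContinuous
    { toFun := fun f => UnitAddTorus.mFourierCoeff f k
      map_add' := fun f g => by
        simp only [mFourierCoeff_eq]
        rw [← integral_add (integrable_mFourier_smul (integrable_LpTorus f) _)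
          (integrable_mFourier_smul (integrable_LpTorus g) _)]
        refine integral_congr_ae ((Lp.coeFn_add f g).mono fun x hx => ?_)
        simp only [hx, Pi.add_apply, smul_add]
      map_smul' := fun c f => by
        simp only [mFourierCoeff_eq, RingHom.id_apply]
        rw [← integral_smul]
        refine integral_congr_ae ((Lp.coeFn_smul c f).mono fun x hx => ?_)
        simp only [hx, Pi.smul_apply]
        rw [smul_comm] } 1 fun f => by
    simp only [LinearMap.coe_mk, AddHom.coe_mk, mFourierCoeff_eq, one_mul]
    refine (norm_integral_le_integral_norm _).trans ?_
    simp only [norm_smul, norm_mFourier_apply, one_mul]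
    rw [integral_norm_eq_lintegral_enorm (Lp.aestronglyMeasurable f), Lp.norm_def,
      ← eLpNorm_one_eq_lintegral_enorm]
    exact ENNReal.toReal_mono (Lp.eLpNorm_ne_top f)
      (eLpNorm_le_eLpNorm_of_exponent_le hp.out (Lp.aestronglyMeasurable f))

theorem coeffCLM_apply {n : ℕ} {p : ℝ≥0∞} [Fact (1 ≤ p)] (k : Fin n → ℤ) (f : LpTorus n p) :
    coeffCLM n p k f = UnitAddTorus.mFourierCoeff f k := rfl

/-- The image in the torus of the point `t y / (2π)` of `ℝⁿ`. -/
noncomputable def torusPoint {n : ℕ} (t : ℝ) (y : EuclideanSpace ℝ (Fin n)) :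
    UnitAddTorus (Fin n) :=
  fun i => ((t * y i / (2 * Real.pi) : ℝ) : UnitAddCircle)

theorem continuous_torusPoint {n : ℕ} (t : ℝ) :
    Continuous (torusPoint t : EuclideanSpace ℝ (Fin n) → UnitAddTorus (Fin n)) := by
  refine continuous_pi fun i => (AddCircle.continuous_mk' (1 : ℝ)).comp ?_
  fun_prop

theorem mFourier_torusPoint {n : ℕ} (t : ℝ) (y : EuclideanSpace ℝ (Fin n)) (k : Fin n → ℤ) :
    UnitAddTorus.mFourier (-k) (torusPoint t y) =
      Complex.exp (-(Complex.I * ((inner ℝ (t • latticePoint k) y : ℝ) : ℂ))) := by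
  have hpi : (Real.pi : ℂ) ≠ 0 := by exact_mod_cast Real.pi_ne_zero
  simp only [UnitAddTorus.mFourier, torusPoint, latticePoint, ContinuousMap.coe_mk,
    fourier_coe_apply, ← Complex.exp_sum, PiLp.inner_apply]
  congr 1
  push_cast
  rw [Finset.mul_sum, ← Finset.sum_neg_distrib]
  refine Finset.sum_congr rfl fun i _ => ?_
  simp
  field_simp

theorem measurePreserving_translate {n : ℕ} (a : UnitAddTorus (Fin n)) :
    MeasurePreserving (fun x => x - a) (torusMeasure n) (torusMeasure n) :=
  measurePreserving_sub_right _ a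

/-- The translate `f(· - a)` in `L^p(𝕋ⁿ)`. -/
noncomputable def translate {n : ℕ} {p : ℝ≥0∞} (f : LpTorus n p)
    (a : UnitAddTorus (Fin n)) : LpTorus n p :=
  Lp.compMeasurePreserving (fun x => x - a) (measurePreserving_translate a) f

theorem continuous_translate {n : ℕ} {p : ℝ≥0∞} [Fact (1 ≤ p)] (hp : p ≠ ∞) (f : LpTorus n p) :
    Continuous (translate f) := by
  let G : C(UnitAddTorus (Fin n), C(UnitAddTorus (Fin n), UnitAddTorus (Fin n))) :=
    ContinuousMap.curry ⟨fun q => q.2 - q.1, by fun_prop⟩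
  exact Continuous.compMeasurePreservingLp (f := fun _ => f) (g := G) continuous_const
    G.continuous (fun a => measurePreserving_translate a) hp

theorem mFourierCoeff_translate {n : ℕ} {p : ℝ≥0∞} (f : LpTorus n p) (a : UnitAddTorus (Fin n))
    (k : Fin n → ℤ) : UnitAddTorus.mFourierCoeff (translate f a) k =
      UnitAddTorus.mFourier (-k) a * UnitAddTorus.mFourierCoeff f k := by
  simp only [mFourierCoeff_eq]
  rw [← integral_const_mul, ← integral_sub_right_eq_self
    (fun x => UnitAddTorus.mFourier (-k) a * UnitAddTorus.mFourier (-k) x • f x) a]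
  refine integral_congr_ae ?_
  filter_upwards [Lp.coeFn_compMeasurePreserving f (measurePreserving_translate a)] with x hx
  have h : UnitAddTorus.mFourier (-k) x =
      UnitAddTorus.mFourier (-k) (x - a) * UnitAddTorus.mFourier (-k) a := by
    rw [← mFourier_apply_add, sub_add_cancel]
  rw [translate, hx, h]
  simp only [Function.comp_apply, smul_eq_mul]
  ring

theorem exists_transferredMean {n : ℕ} {p : ℝ≥0∞} [Fact (1 ≤ p)] (hp : p ≠ ∞)
    (μ : ComplexMeasure (EuclideanSpace ℝ (Fin n))) (t : ℝ) (f : LpTorus n p) :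
    ∃ g : LpTorus n p, IsTransferredMean μ t f g := by
  have := isFiniteMeasure_variation μ
  let Φ : EuclideanSpace ℝ (Fin n) → LpTorus n p := fun y => translate f (torusPoint t y)
  have hΦ : Integrable Φ μ.variation := by
    refine Integrable.of_bound (C := ‖f‖)
      ((continuous_translate hp f).comp (continuous_torusPoint t)).aestronglyMeasurable
      (Eventually.of_forall fun y => ?_)
    exact (Lp.norm_compMeasurePreserving f (measurePreserving_translate _)).le
  refine ⟨VectorMeasure.integral μ Φ (ContinuousLinearMap.lsmul ℝ ℂ).flip, fun k => ?_⟩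
  rw [← coeffCLM_apply, map_integral μ _ (ContinuousLinearMap.mul ℝ ℂ) (coeffCLM n p k)
    (coeffCLM n p k) ?_ hΦ]
  · have h : (fun y => coeffCLM n p k (Φ y)) = fun y =>
        (ContinuousLinearMap.mul ℝ ℂ) (UnitAddTorus.mFourierCoeff f k)
          (Complex.exp (-(Complex.I * ((inner ℝ (t • latticePoint k) y : ℝ) : ℂ)))) := by
      ext y
      rw [coeffCLM_apply, mFourierCoeff_translate, mFourier_torusPoint, mul_comm]
      rfl
    rw [h, ← map_integral μ (ContinuousLinearMap.mul ℝ ℂ) (ContinuousLinearMap.mul ℝ ℂ)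
      (ContinuousLinearMap.mul ℝ ℂ (UnitAddTorus.mFourierCoeff f k)) _ ?_ ?_]
    · simp [fourierStieltjes, mul_comm]
    · intro e v
      simp [mul_assoc]
    · refine Integrable.of_bound (C := 1) (Continuous.aestronglyMeasurable (by fun_prop))
        (Eventually.of_forall fun y => ?_)
      rw [Complex.norm_exp]
      simp
  · intro e v
    simp only [coeffCLM_apply, ContinuousLinearMap.flip_apply, ContinuousLinearMap.lsmul_apply,
      ContinuousLinearMap.mul_apply', mFourierCoeff_eq]
    rw [mul_comm, ← smul_eq_mul, ← integral_smul]
    refine integral_congr_ae ((Lp.coeFn_smul v e).mono fun x hx => ?_)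
    simp only [hx, Pi.smul_apply]
    rw [smul_comm]

theorem eq_of_mFourierCoeff_eq {n : ℕ} {p : ℝ≥0∞} [Fact (1 ≤ p)] (f g : LpTorus n p)
    (h : ∀ k, UnitAddTorus.mFourierCoeff f k = UnitAddTorus.mFourierCoeff g k) : f = g := by
  let u : UnitAddTorus (Fin n) → ℂ := fun x => f x - g x
  have hu : Integrable u (torusMeasure n) := (integrable_LpTorus f).sub (integrable_LpTorus g)
  have hmul : ∀ φ : C(UnitAddTorus (Fin n), ℂ),
      Integrable (fun x => φ x * u x) (torusMeasure n) := fun φ =>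
    hu.bdd_mul (c := ‖φ‖) φ.continuous.aestronglyMeasurable
      (Eventually.of_forall fun x => φ.norm_coe_le_norm x)
  let A : C(UnitAddTorus (Fin n), ℂ) →L[ℂ] ℂ := LinearMap.mkContinuous
    { toFun := fun φ => ∫ x, φ x * u x ∂torusMeasure n
      map_add' := fun φ ψ => by
        rw [← integral_add (hmul φ) (hmul ψ)]
        simp [add_mul]
      map_smul' := fun c φ => by
        simp [mul_assoc, integral_const_mul] } (∫ x, ‖u x‖ ∂torusMeasure n) fun φ => by
    simp only [LinearMap.coe_mk, AddHom.coe_mk]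
    refine (norm_integral_le_integral_norm _).trans ?_
    rw [mul_comm, ← integral_const_mul]
    refine integral_mono (hmul φ).norm (hu.norm.const_mul _) fun x => ?_
    simp only [norm_mul]
    exact mul_le_mul_of_nonneg_right (φ.norm_coe_le_norm x) (norm_nonneg _)
  have hA : A = 0 := by
    refine ContinuousLinearMap.ext_on (s := Set.range (UnitAddTorus.mFourier (d := Fin n))) ?_ ?_
    · have := UnitAddTorus.span_mFourier_closure_eq_top (d := Fin n)
      exact Submodule.dense_iff_topologicalClosure_eq_top.2 this
    · rintro _ ⟨k, rfl⟩
      have hk := h (-k)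
      simp only [mFourierCoeff_eq, neg_neg] at hk
      change ∫ x, UnitAddTorus.mFourier k x * (f x - g x) ∂torusMeasure n = 0
      simp only [mul_sub]
      rw [integral_sub, sub_eq_zero]
      · exact hk
      · exact integrable_mFourier_smul (integrable_LpTorus f) k
      · exact integrable_mFourier_smul (integrable_LpTorus g) k
  have hu0 : u =ᵐ[torusMeasure n] 0 := by
    refine ae_eq_zero_of_forall_setIntegral_isClosed_eq_zero hu fun s hs => ?_
    let δ : ℕ → ℝ := fun m => 1 / ((m : ℝ) + 1)
    have hδ : ∀ m, 0 < δ m := fun m => by positivity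
    have hlim := thickenedIndicator_tendsto_indicator_closure hδ
      tendsto_one_div_add_atTop_nhds_zero_nat s
    rw [hs.closure_eq, tendsto_pi_nhds] at hlim
    rw [← integral_indicator hs.measurableSet]
    have hzero : ∀ m, ∫ x, (((thickenedIndicator (hδ m) s x : NNReal) : ℝ) : ℂ) * u x
        ∂torusMeasure n = 0 := fun m => by
      have := DFunLike.congr_fun hA ⟨fun x => (((thickenedIndicator (hδ m) s x : NNReal) : ℝ) : ℂ),
        by fun_prop⟩
      exact this
    refine tendsto_nhds_unique ?_ (tendsto_const_nhds (x := (0 : ℂ)) (f := (atTop : Filter ℕ)))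
    refine Tendsto.congr hzero ?_
    refine tendsto_integral_of_dominated_convergence (fun x => ‖u x‖) ?_ hu.norm ?_ ?_
    · intro m
      refine AEStronglyMeasurable.mul (Continuous.aestronglyMeasurable ?_) hu.aestronglyMeasurable
      fun_prop
    · intro m
      refine Eventually.of_forall fun x => ?_
      have h1 : ((thickenedIndicator (hδ m) s x : NNReal) : ℝ) ≤ 1 := by
        exact_mod_cast thickenedIndicator_le_one (hδ m) s x
      rw [norm_mul, Complex.norm_real, Real.norm_of_nonneg (NNReal.coe_nonneg _)]
      exact mul_le_of_le_one_left (norm_nonneg _) h1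
    · refine Eventually.of_forall fun x => ?_
      have h1 : Tendsto (fun m => (((thickenedIndicator (hδ m) s x : NNReal) : ℝ) : ℂ)) atTop
          (𝓝 (((s.indicator (fun _ => (1 : NNReal)) x : NNReal) : ℝ) : ℂ)) :=
        ((Complex.continuous_ofReal.comp NNReal.continuous_coe).tendsto _).comp (hlim x)
      have h2 : s.indicator u x =
          (((s.indicator (fun _ => (1 : NNReal)) x : NNReal) : ℝ) : ℂ) * u x := by
        by_cases hx : x ∈ s <;> simp [hx]
      rw [h2]
      exact h1.mul_const _
  refine Lp.ext (hu0.mono fun x hx => ?_)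
  exact sub_eq_zero.1 hx

/-- The Fourier multiplier operator `M_μ^t` on `L^p(𝕋ⁿ)`: the element of `L^p(𝕋ⁿ)` whose Fourier
series is `∑ₖ μ̂(t k) f̂(k) e_k`. -/
noncomputable def transferredMean {n : ℕ} {p : ℝ≥0∞} [Fact (1 ≤ p)] (hp : p ≠ ∞)
    (μ : ComplexMeasure (EuclideanSpace ℝ (Fin n))) (t : ℝ) (f : LpTorus n p) : LpTorus n p :=
  (exists_transferredMean hp μ t f).choose

theorem transferredMean_spec {n : ℕ} {p : ℝ≥0∞} [Fact (1 ≤ p)] (hp : p ≠ ∞)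
    (μ : ComplexMeasure (EuclideanSpace ℝ (Fin n))) (t : ℝ) (f : LpTorus n p) :
    IsTransferredMean μ t f (transferredMean hp μ t f) :=
  (exists_transferredMean hp μ t f).choose_spec

theorem eq_transferredMean {n : ℕ} {p : ℝ≥0∞} [Fact (1 ≤ p)] (hp : p ≠ ∞)
    (μ : ComplexMeasure (EuclideanSpace ℝ (Fin n))) (t : ℝ) (f g : LpTorus n p)
    (hg : IsTransferredMean μ t f g) : g = transferredMean hp μ t f :=
  eq_of_mFourierCoeff_eq _ _ fun k => (hg k).trans (transferredMean_spec hp μ t f k).symm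

end TorusMultiplier

/-! Put `g = M_μ^t f - f`. Since `|ĝ(k)| = |1 - μ̂(tk)| |f̂(k)|` and `|1 - μ̂|` is bounded below
away from the origin, a small `‖g‖` forces `f̂(k)` to be small once `|k|` is at least of order
`1/t`.

Given `m` nonzero frequencies, a fixed proportion of them satisfy `|k| > m^(1/n)/4`
(`card_le_four_mul_card_filter`). Take `t` of order `m^(-1/n)` and let `N`, comparable to `m`, be
the number of these far frequencies. Testing `g` against a trigonometric polynomial gives `∑ |ĝ(k)|
≤ N^(1/p) ‖g‖` over them (`sum_norm_mFourierCoeff_le`), so the smallest `|f̂(k)|` among them is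
`O(m^(1/p - 1) t^α) = O(m^(-s))` with `s = α/n + 1 - 1/p` (`exists_norm_mFourierCoeff_le`).

As this holds for every finite set of nonzero frequencies, the decreasing rearrangement of `f̂` is
`O(m^(-s))`: `f̂` lies in weak `ℓ^(1/s)`, hence in `ℓ^β` for all `β > 1/s = np/(np + αp - n)`. If `α
> n/p`, then `β = 1` is allowed. No dyadic decomposition is needed. -/

namespace TorusMultiplier

/-! ### Summability from decay of the decreasing rearrangement. -/

/-- If every nonempty finite set `S` contains an index with `b k ≤ D * #S ^ (-s)`, then `b ^ β` is
summable for every `β > 1 / s`. -/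
theorem summable_rpow_of_exists_le {ι : Type*} {b : ι → ℝ} (hb : ∀ k, 0 ≤ b k) {D s β : ℝ}
    (hβ : 0 < β) (hsβ : 1 < s * β)
    (h : ∀ S : Finset ι, S.Nonempty → ∃ k ∈ S, b k ≤ D * (S.card : ℝ) ^ (-s)) :
    Summable fun k => b k ^ β := by
  classical
  -- `a m` bounds the term removed from a set of size `m`; the entry `a 0` only needs to be
  -- nonnegative.
  let a : ℕ → ℝ := fun m => |D| ^ β * (m : ℝ) ^ (-(s * β))
  have ha0 : ∀ m, 0 ≤ a m := fun m => by positivity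
  have ha : Summable a := (Real.summable_nat_rpow.2 (by linarith)).mul_left _
  have key : ∀ m : ℕ, ∀ S : Finset ι, S.card = m →
      ∑ k ∈ S, b k ^ β ≤ ∑ i ∈ Finset.range (m + 1), a i := by
    intro m
    induction m with
    | zero =>
      intro S hS
      rw [Finset.card_eq_zero.1 hS]
      simpa using ha0 0
    | succ m ih =>
      intro S hS
      obtain ⟨k, hk, hle⟩ := h S (Finset.card_pos.1 (by omega))
      -- Peel off the small element and apply induction to the remaining `m` indices.
      rw [← Finset.sum_erase_add _ _ hk, Finset.sum_range_succ]
      refine add_le_add (ih _ (by rw [Finset.card_erase_of_mem hk, hS]; rfl)) ?_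
      have h1 : b k ≤ |D| * ((m + 1 : ℕ) : ℝ) ^ (-s) := by
        rw [hS] at hle
        exact hle.trans (mul_le_mul_of_nonneg_right (le_abs_self D) (by positivity))
      calc b k ^ β ≤ (|D| * ((m + 1 : ℕ) : ℝ) ^ (-s)) ^ β := Real.rpow_le_rpow (hb k) h1 hβ.le
        _ = a (m + 1) := by
          rw [Real.mul_rpow (abs_nonneg D) (by positivity), ← Real.rpow_mul (by positivity),
            neg_mul]
  refine summable_of_sum_le (c := ∑' m, a m) (fun k => Real.rpow_nonneg (hb k) β) fun S => ?_
  exact (key _ S rfl).trans (ha.sum_le_tsum _ fun i _ => ha0 i)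

/-! ### Counting lattice points. -/

/-- A finite set of `m` nonzero lattice points has at least `m / 4` points outside the cube of
half-side `m ^ (1 / n) / 4`. -/
theorem card_le_four_mul_card_filter {n : ℕ} (hn : n ≠ 0) (S : Finset (Fin n → ℤ))
    (h0 : (0 : Fin n → ℤ) ∉ S) :
    (S.card : ℝ) ≤ 4 * ((S.filter fun k => (S.card : ℝ) ^ (1 / (n : ℝ)) / 4 <
      ‖latticePoint k‖).card : ℝ) := by
  classical
  set r : ℝ := (S.card : ℝ) ^ (1 / (n : ℝ)) with hr
  have hr0 : 0 ≤ r := by positivity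
  have hrn : r ^ n = S.card := by
    rw [hr, ← Real.rpow_natCast, ← Real.rpow_mul (by positivity),
      one_div_mul_cancel (by exact_mod_cast hn), Real.rpow_one]
  set L : ℕ := ⌊r / 4⌋₊ with hL
  have hsplit := S.card_filter_add_card_filter_not (p := fun k => r / 4 < ‖latticePoint k‖)
  have hsub : S.filter (fun k => ¬ r / 4 < ‖latticePoint k‖) ⊆
      (Fintype.piFinset fun _ : Fin n => Finset.Icc (-(L : ℤ)) L).erase 0 := by
    intro k hk
    obtain ⟨hkS, hk⟩ := Finset.mem_filter.1 hk
    refine Finset.mem_erase.2 ⟨fun h => h0 (h ▸ hkS), Fintype.mem_piFinset.2 fun i => ?_⟩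
    have h1 : |(k i : ℝ)| ≤ r / 4 := by
      have := PiLp.norm_apply_le (latticePoint k) i
      rw [latticePoint, PiLp.toLp_apply, Real.norm_eq_abs] at this
      exact this.trans (not_lt.1 hk)
    have h2 : (k i).natAbs ≤ L := by
      refine Nat.le_floor ?_
      rwa [Nat.cast_natAbs, Int.cast_abs]
    rw [Finset.mem_Icc]
    omega
  have hcard : ((S.filter fun k => ¬ r / 4 < ‖latticePoint k‖).card : ℝ) ≤ 3 / 4 * S.card := by
    -- For `L = 0` the cube contains only the origin, which `S` omits. For `L ≥ 1`, `2L + 1 ≤ 3L ≤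
    -- 3r/4`, so the cube has at most `(3/4)^n m ≤ 3m/4` lattice points.
    rcases Nat.eq_zero_or_pos L with hL0 | hL0
    · have : S.filter (fun k => ¬ r / 4 < ‖latticePoint k‖) = ∅ := by
        refine Finset.subset_empty.1 (hsub.trans fun k hk => ?_)
        obtain ⟨hk0, hk⟩ := Finset.mem_erase.1 hk
        refine (hk0 (funext fun i => ?_)).elim
        have := Fintype.mem_piFinset.1 hk i
        rw [hL0] at this
        simpa using this
      rw [this]
      simp
    · have h1 : (S.filter fun k => ¬ r / 4 < ‖latticePoint k‖).card ≤ (2 * L + 1) ^ n := by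
        refine (Finset.card_le_card (hsub.trans (Finset.erase_subset _ _))).trans (le_of_eq ?_)
        rw [Fintype.card_piFinset]
        simp only [Int.card_Icc, Finset.prod_const, Finset.card_univ, Fintype.card_fin]
        congr 1
        omega
      have h2 : ((2 * L + 1 : ℕ) : ℝ) ≤ 3 / 4 * r := by
        have h3 : (L : ℝ) ≤ r / 4 := Nat.floor_le (by positivity)
        have h4 : (1 : ℝ) ≤ L := by exact_mod_cast hL0
        push_cast
        linarith
      calc ((S.filter fun k => ¬ r / 4 < ‖latticePoint k‖).card : ℝ)
          ≤ ((2 * L + 1 : ℕ) : ℝ) ^ n := by exact_mod_cast h1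
        _ ≤ (3 / 4 * r) ^ n := pow_le_pow_left₀ (by positivity) h2 n
        _ = (3 / 4) ^ n * S.card := by rw [mul_pow, hrn]
        _ ≤ 3 / 4 * S.card := by
          refine mul_le_mul_of_nonneg_right ?_ (by positivity)
          exact pow_le_of_le_one (by norm_num) (by norm_num) hn
  have : ((S.filter fun k => r / 4 < ‖latticePoint k‖).card : ℝ) +
      (S.filter fun k => ¬ r / 4 < ‖latticePoint k‖).card = S.card := by exact_mod_cast hsplit
  linarith

/-! ### Hausdorff–Young summed over a finite set of frequencies. -/

theorem lintegral_enorm_sq_trigPolynomial_le {n : ℕ} (S : Finset (Fin n → ℤ))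
    (u : (Fin n → ℤ) → ℂ) (hu : ∀ k, ‖u k‖ ≤ 1) :
    ∫⁻ x, ‖∑ k ∈ S, u k * UnitAddTorus.mFourier (-k) x‖ₑ ^ (2 : ℝ) ∂torusMeasure n ≤ S.card := by
  let T : C(UnitAddTorus (Fin n), ℂ) := ∑ k ∈ S, u k • UnitAddTorus.mFourier (-k)
  have hT : ∀ x, T x = ∑ k ∈ S, u k * UnitAddTorus.mFourier (-k) x := fun x => by
    simp [T, ContinuousMap.sum_apply]
  let φ := ContinuousMap.toLp (E := ℂ) 2 (torusMeasure n) ℂ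
  have hφ : φ T = ∑ k ∈ S, u k • φ (UnitAddTorus.mFourier (-k)) := by
    simp only [T, φ, map_sum, map_smul]
  have horth : Orthonormal ℂ fun k : Fin n → ℤ => φ (UnitAddTorus.mFourier (-k)) :=
    UnitAddTorus.orthonormal_mFourier.comp _ neg_injective
  have hnorm : ‖φ T‖ ^ 2 ≤ S.card := by
    have h1 : ((‖φ T‖ ^ 2 : ℝ) : ℂ) = ((∑ k ∈ S, ‖u k‖ ^ 2 : ℝ) : ℂ) := by
      push_cast
      refine (inner_self_eq_norm_sq_to_K (𝕜 := ℂ) (φ T)).symm.trans ?_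
      rw [hφ, horth.inner_sum]
      exact Finset.sum_congr rfl fun k _ => Complex.conj_mul' _
    rw [Complex.ofReal_injective h1]
    refine (Finset.sum_le_sum fun k _ => pow_le_one₀ (norm_nonneg _) (hu k)).trans ?_
    simp
  have h2 : eLpNorm T 2 (torusMeasure n) = ‖φ T‖ₑ := by
    rw [Lp.enorm_def]
    exact (eLpNorm_congr_ae (ContinuousMap.coeFn_toLp (torusMeasure n) T)).symm
  have h3 : (∫⁻ x, ‖T x‖ₑ ^ (2 : ℝ) ∂torusMeasure n) = ‖φ T‖ₑ ^ 2 := by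
    rw [← h2, ← ENNReal.rpow_natCast,
      eLpNorm_eq_lintegral_rpow_enorm_toReal (by norm_num) (by norm_num), ← ENNReal.rpow_mul]
    norm_num
  simp only [← hT, h3]
  rw [← ofReal_norm, ← ENNReal.ofReal_pow (norm_nonneg _), ← ENNReal.ofReal_natCast]
  exact ENNReal.ofReal_le_ofReal hnorm

theorem enorm_trigPolynomial_le {n : ℕ} (S : Finset (Fin n → ℤ))
    (u : (Fin n → ℤ) → ℂ) (hu : ∀ k, ‖u k‖ ≤ 1) (x : UnitAddTorus (Fin n)) :
    ‖∑ k ∈ S, u k * UnitAddTorus.mFourier (-k) x‖ₑ ≤ S.card := by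
  rw [← ofReal_norm, ← ENNReal.ofReal_natCast]
  refine ENNReal.ofReal_le_ofReal ((norm_sum_le _ _).trans ?_)
  refine (Finset.sum_le_sum fun k _ => ?_).trans (le_of_eq (b := ∑ _k ∈ S, (1 : ℝ)) rfl) |>.trans ?_
  · rw [norm_mul, norm_mFourier_apply, mul_one]
    exact hu k
  · simp

/-- Hölder's inequality, with the `L^q` norm of the polynomial, `q = p'`, interpolated between
Parseval and the trivial sup bound: `∫ |T|^q ≤ N^(q-2) ∫ |T|² ≤ N^(q-1)` with `N = #S`, and `(q -
1)/q = 1/p`. -/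
theorem lintegral_trigPolynomial_mul_le {n : ℕ} {p : ℝ≥0∞} [hp1 : Fact (1 ≤ p)] (hp : p ≤ 2)
    (g : LpTorus n p) (S : Finset (Fin n → ℤ)) (hS : S.Nonempty)
    (u : (Fin n → ℤ) → ℂ) (hu : ∀ k, ‖u k‖ ≤ 1) :
    ∫⁻ x, ‖∑ k ∈ S, u k * UnitAddTorus.mFourier (-k) x‖ₑ * ‖g x‖ₑ ∂torusMeasure n ≤
      (S.card : ℝ≥0∞) ^ (1 / p.toReal) * ‖g‖ₑ := by
  have hp0 : p ≠ 0 := (zero_lt_one.trans_le hp1.out).ne'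
  have hptop : p ≠ ∞ := ne_top_of_le_ne_top ENNReal.ofNat_ne_top hp
  have hg : AEMeasurable (fun x => ‖g x‖ₑ) (torusMeasure n) :=
    (Lp.aestronglyMeasurable g).enorm
  have hT : Measurable fun x : UnitAddTorus (Fin n) =>
      ‖∑ k ∈ S, u k * UnitAddTorus.mFourier (-k) x‖ₑ := by
    refine (Continuous.measurable ?_).enorm
    fun_prop
  have hgn : ‖g‖ₑ = (∫⁻ x, ‖g x‖ₑ ^ p.toReal ∂torusMeasure n) ^ (1 / p.toReal) := by
    rw [Lp.enorm_def, eLpNorm_eq_lintegral_rpow_enorm_toReal hp0 hptop]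
  rcases hp1.out.eq_or_lt with h1 | h1
  · subst h1
    simp only [ENNReal.toReal_one, div_one, ENNReal.rpow_one] at hgn ⊢
    rw [hgn, ← lintegral_const_mul'' _ hg]
    exact lintegral_mono fun x => mul_le_mul_left (enorm_trigPolynomial_le S u hu x) _
  · have hP1 : 1 < p.toReal := by
      rwa [← ENNReal.toReal_one, ENNReal.toReal_lt_toReal ENNReal.one_ne_top hptop]
    have hP2 : p.toReal ≤ 2 := by
      simpa using ENNReal.toReal_mono ENNReal.ofNat_ne_top hp
    have hc : p.toReal.HolderConjugate (p.toReal / (p.toReal - 1)) := .conjExponent hP1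
    set q := p.toReal / (p.toReal - 1) with hq
    -- This is where `p ≤ 2` enters: `|T|^(q-2)` can be bounded by the sup norm only if `q - 2 ≥ 0`.
    have hq2 : 2 ≤ q := by
      rw [hq, le_div_iff₀ (by linarith)]
      linarith
    have hN0 : (S.card : ℝ≥0∞) ≠ 0 := by simpa using hS.ne_empty
    have hNtop : (S.card : ℝ≥0∞) ≠ ∞ := ENNReal.natCast_ne_top _
    have hTq : ∫⁻ x, ‖∑ k ∈ S, u k * UnitAddTorus.mFourier (-k) x‖ₑ ^ q ∂torusMeasure n ≤
        (S.card : ℝ≥0∞) ^ (q - 1) := by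
      calc ∫⁻ x, ‖∑ k ∈ S, u k * UnitAddTorus.mFourier (-k) x‖ₑ ^ q ∂torusMeasure n
          ≤ ∫⁻ x, (S.card : ℝ≥0∞) ^ (q - 2) *
              ‖∑ k ∈ S, u k * UnitAddTorus.mFourier (-k) x‖ₑ ^ (2 : ℝ) ∂torusMeasure n := by
            refine lintegral_mono fun x => ?_
            have h : q = (q - 2) + 2 := by ring
            nth_rw 1 [h]
            rw [ENNReal.rpow_add_of_nonneg _ _ (by linarith) (by norm_num)]
            exact mul_le_mul_left (ENNReal.rpow_le_rpow (enorm_trigPolynomial_le S u hu x)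
              (by linarith)) _
        _ = (S.card : ℝ≥0∞) ^ (q - 2) * ∫⁻ x,
              ‖∑ k ∈ S, u k * UnitAddTorus.mFourier (-k) x‖ₑ ^ (2 : ℝ) ∂torusMeasure n :=
            lintegral_const_mul _ (hT.pow_const _)
        _ ≤ (S.card : ℝ≥0∞) ^ (q - 2) * S.card :=
            mul_le_mul_right (lintegral_enorm_sq_trigPolynomial_le S u hu) _
        _ = (S.card : ℝ≥0∞) ^ (q - 1) := by
            nth_rw 2 [← ENNReal.rpow_one (S.card : ℝ≥0∞)]
            rw [← ENNReal.rpow_add _ _ hN0 hNtop]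
            congr 1
            ring
    refine (ENNReal.lintegral_mul_le_Lp_mul_Lq _ hc.symm hT.aemeasurable hg).trans ?_
    rw [hgn]
    refine mul_le_mul_left ((ENNReal.rpow_le_rpow hTq (by positivity)).trans (le_of_eq ?_)) _
    rw [← ENNReal.rpow_mul]
    congr 1
    rw [hq]
    have : p.toReal - 1 ≠ 0 := by linarith
    field_simp
    ring

/-- A summed form of the Hausdorff–Young inequality. -/
theorem sum_norm_mFourierCoeff_le {n : ℕ} {p : ℝ≥0∞} [Fact (1 ≤ p)] (hp : p ≤ 2)
    (g : LpTorus n p) (S : Finset (Fin n → ℤ)) (hS : S.Nonempty) :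
    ∑ k ∈ S, ‖UnitAddTorus.mFourierCoeff g k‖ ≤ (S.card : ℝ) ^ (1 / p.toReal) * ‖g‖ := by
  let c : (Fin n → ℤ) → ℂ := fun k => UnitAddTorus.mFourierCoeff g k
  -- The conjugate phase of `c k`; where `c k = 0` the quotient is `0`, so only `‖u k‖ ≤ 1` holds in
  -- general.
  let u : (Fin n → ℤ) → ℂ := fun k => starRingEnd ℂ (c k) / ‖c k‖
  have hu : ∀ k, ‖u k‖ ≤ 1 := fun k => by
    simp only [u, norm_div, RCLike.norm_conj, Complex.norm_real, norm_norm]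
    exact div_self_le_one _
  have huc : ∀ k, u k * c k = ‖c k‖ := fun k => by
    simp only [u, div_mul_eq_mul_div, Complex.conj_mul']
    by_cases h : c k = 0
    · simp [h]
    · have : (‖c k‖ : ℂ) ≠ 0 := by simpa using h
      field_simp
  have hsum : ((∑ k ∈ S, ‖c k‖ : ℝ) : ℂ) =
      ∫ x, (∑ k ∈ S, u k * UnitAddTorus.mFourier (-k) x) * g x ∂torusMeasure n := by
    simp only [Finset.sum_mul, mul_assoc]
    rw [integral_finsetSum]
    · push_cast
      refine Finset.sum_congr rfl fun k _ => ?_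
      rw [← huc, integral_const_mul]
      rfl
    · intro k _
      exact (integrable_mFourier_smul (integrable_LpTorus g) (-k)).const_mul _
  have h0 : 0 ≤ ∑ k ∈ S, ‖c k‖ := Finset.sum_nonneg fun k _ => norm_nonneg _
  have h1 : ENNReal.ofReal (∑ k ∈ S, ‖c k‖) ≤
      (S.card : ℝ≥0∞) ^ (1 / p.toReal) * ‖g‖ₑ := by
    refine le_trans ?_ (lintegral_trigPolynomial_mul_le hp g S hS u hu)
    have h2 : ENNReal.ofReal (∑ k ∈ S, ‖c k‖) = ‖((∑ k ∈ S, ‖c k‖ : ℝ) : ℂ)‖ₑ := by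
      rw [← ofReal_norm, Complex.norm_real, Real.norm_of_nonneg h0]
    rw [h2, hsum]
    refine (enorm_integral_le_lintegral_enorm _).trans (le_of_eq ?_)
    simp only [enorm_mul]
  have h3 : (S.card : ℝ≥0∞) ^ (1 / p.toReal) * ‖g‖ₑ =
      ENNReal.ofReal ((S.card : ℝ) ^ (1 / p.toReal) * ‖g‖) := by
    rw [ENNReal.ofReal_mul (by positivity), ofReal_norm,
      ← ENNReal.ofReal_rpow_of_nonneg (by positivity) (by positivity), ENNReal.ofReal_natCast]
  rw [h3] at h1
  exact (ENNReal.ofReal_le_ofReal_iff (by positivity)).1 h1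

/-! ### Decay and summability of the Fourier coefficients. -/

theorem norm_mFourierCoeff_transferredMean_sub {n : ℕ} {p : ℝ≥0∞} [Fact (1 ≤ p)] (hp : p ≠ ∞)
    (μ : ComplexMeasure (EuclideanSpace ℝ (Fin n))) (t : ℝ) (f : LpTorus n p) (k : Fin n → ℤ) :
    ‖UnitAddTorus.mFourierCoeff (transferredMean hp μ t f - f : LpTorus n p) k‖ =
      ‖1 - fourierStieltjes μ (t • latticePoint k)‖ * ‖UnitAddTorus.mFourierCoeff f k‖ := by
  rw [← coeffCLM_apply, map_sub, coeffCLM_apply, coeffCLM_apply, transferredMean_spec hp μ t f k,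
    ← sub_one_mul, norm_mul, norm_sub_rev]

/-- If `‖M_μ^t f - f‖ = O(t ^ α)`, then each finite set `S` of nonzero frequencies contains one
whose Fourier coefficient is `O(#S ^ (-(α / n + 1 - 1 / p)))`. -/
theorem exists_norm_mFourierCoeff_le {n : ℕ} (hn : n ≠ 0) {σ : ℝ}
    {μ : ComplexMeasure (EuclideanSpace ℝ (Fin n))} (hμ : ClassK σ μ)
    {p : ℝ≥0∞} [hp1 : Fact (1 ≤ p)] (hp : p ≤ 2) (hptop : p ≠ ∞) (f : LpTorus n p) {α : ℝ}
    (hO : (fun t : ℝ => ‖transferredMean hptop μ t f - f‖) =O[𝓝[>] 0] (fun t : ℝ => t ^ α)) :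
    ∃ D : ℝ, ∀ S : Finset (Fin n → ℤ), S.Nonempty → (0 : Fin n → ℤ) ∉ S →
      ∃ k ∈ S, ‖UnitAddTorus.mFourierCoeff f k‖ ≤
        D * (S.card : ℝ) ^ (-(α / n + (1 - 1 / p.toReal))) := by
  obtain ⟨hσ, -, c, C, hc, -, hcC⟩ := hμ
  obtain ⟨C₀, hC₀, hbound⟩ := hO.exists_pos
  obtain ⟨ε, hε, hball⟩ := (nhdsGT_basis (0 : ℝ)).eventually_iff.1 hbound.bound
  have hP1 : 1 ≤ p.toReal := by
    simpa using ENNReal.toReal_mono hptop hp1.out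
  have hθ : 1 / p.toReal - 1 ≤ 0 := by
    rw [sub_nonpos, div_le_one (by linarith)]
    exact hP1
  -- Halving `ε` keeps `t = δ / r ≤ δ` strictly inside the range of the `O`-bound, whatever the size
  -- of `S`.
  set δ := ε / 2 with hδ
  have hδ0 : 0 < δ := by positivity
  -- Lower bound for `|1 - μ̂(ξ)|` on `|ξ| ≥ δ/4`; the far frequencies `|k| > r/4` satisfy this with
  -- `ξ = tk`.
  set c₀ : ℝ := c * min 1 ((δ / 4) ^ (2 * σ)) with hc₀
  have hc₀0 : 0 < c₀ := mul_pos hc (lt_min one_pos (by positivity))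
  refine ⟨C₀ * δ ^ α / c₀ * (1 / 4) ^ (1 / p.toReal - 1), fun S hS h0 => ?_⟩
  set m : ℝ := (S.card : ℝ) with hm
  have hm1 : 1 ≤ m := Nat.one_le_cast.2 hS.card_pos
  set r : ℝ := m ^ (1 / (n : ℝ)) with hr
  have hr1 : 1 ≤ r := Real.one_le_rpow hm1 (by positivity)
  set t : ℝ := δ / r with ht
  have ht0 : 0 < t := by positivity
  have htδ : t < ε := (div_le_self hδ0.le hr1).trans_lt (by linarith)
  set g : LpTorus n p := transferredMean hptop μ t f - f with hg
  have hgle : ‖g‖ ≤ C₀ * t ^ α := by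
    have := hball ⟨ht0, htδ⟩
    rwa [norm_norm, Real.norm_of_nonneg (by positivity)] at this
  have hcard := card_le_four_mul_card_filter hn S h0
  rw [← hm, ← hr] at hcard
  set S' := S.filter fun k => r / 4 < ‖latticePoint k‖ with hS'
  have hm'0 : 0 < (S'.card : ℝ) := by linarith
  have hS'ne : S'.Nonempty := Finset.card_pos.1 (by exact_mod_cast hm'0)
  obtain ⟨k₀, hk₀, hmin⟩ := S'.exists_min_image (fun k => ‖UnitAddTorus.mFourierCoeff f k‖) hS'ne
  refine ⟨k₀, (Finset.mem_filter.1 hk₀).1, ?_⟩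
  have hlow : ∀ k ∈ S', c₀ * ‖UnitAddTorus.mFourierCoeff f k₀‖ ≤
      ‖UnitAddTorus.mFourierCoeff g k‖ := fun k hk => by
    rw [hg, norm_mFourierCoeff_transferredMean_sub]
    refine mul_le_mul ?_ (hmin k hk) (norm_nonneg _) (norm_nonneg _)
    refine le_trans ?_ (hcC _).1
    have h1 : δ / 4 ≤ ‖t • latticePoint k‖ := by
      rw [norm_smul, Real.norm_of_nonneg ht0.le]
      calc δ / 4 = t * (r / 4) := by rw [ht]; field_simp
        _ ≤ _ := mul_le_mul_of_nonneg_left (Finset.mem_filter.1 hk).2.le ht0.le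
    have h2 := Real.rpow_le_rpow (by positivity) h1 (by positivity : 0 ≤ 2 * σ)
    exact mul_le_mul_of_nonneg_left (min_le_min le_rfl h2) hc.le
  have hsum : (S'.card : ℝ) * (c₀ * ‖UnitAddTorus.mFourierCoeff f k₀‖) ≤
      (S'.card : ℝ) ^ (1 / p.toReal) * (C₀ * t ^ α) := by
    rw [← nsmul_eq_mul]
    exact (Finset.card_nsmul_le_sum _ _ _ hlow).trans
      ((sum_norm_mFourierCoeff_le hp g S' hS'ne).trans
        (mul_le_mul_of_nonneg_left hgle (by positivity)))
  have htα : t ^ α = δ ^ α * m ^ (-(α / n)) := by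
    rw [ht, Real.div_rpow hδ0.le (by positivity), hr, ← Real.rpow_mul (by positivity),
      Real.rpow_neg (by positivity), div_eq_mul_inv, one_div_mul_eq_div]
  calc ‖UnitAddTorus.mFourierCoeff f k₀‖
      ≤ C₀ * t ^ α / c₀ * (S'.card : ℝ) ^ (1 / p.toReal - 1) := by
        rw [Real.rpow_sub hm'0, Real.rpow_one, div_mul_div_comm, le_div_iff₀ (by positivity)]
        linarith
    -- The exponent is nonpositive, so the lower bound `#S' ≥ m/4` gives an upper bound.
    _ ≤ C₀ * t ^ α / c₀ * (1 / 4 * m) ^ (1 / p.toReal - 1) := by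
        refine mul_le_mul_of_nonneg_left ?_ (by positivity)
        exact Real.rpow_le_rpow_of_nonpos (by positivity) (by linarith) hθ
    _ = _ := by
        rw [htα, Real.mul_rpow (by norm_num) (by positivity), neg_add, neg_sub,
          Real.rpow_add (by positivity)]
        ring

/-- The threshold on `β` is `1/s` for the decay exponent `s = α/n + 1 - 1/p`. -/
theorem summable_norm_mFourierCoeff_rpow {n : ℕ} (hn : n ≠ 0) {σ : ℝ}
    {μ : ComplexMeasure (EuclideanSpace ℝ (Fin n))} (hμ : ClassK σ μ)
    {p : ℝ≥0∞} [hp1 : Fact (1 ≤ p)] (hp : p ≤ 2) (hptop : p ≠ ∞) (f : LpTorus n p) {α β : ℝ}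
    (hα : 0 < α)
    (hO : (fun t : ℝ => ‖transferredMean hptop μ t f - f‖) =O[𝓝[>] 0] (fun t : ℝ => t ^ α))
    (hβ : n * p.toReal / (n * p.toReal + α * p.toReal - n) < β) :
    Summable fun k : Fin n → ℤ => ‖UnitAddTorus.mFourierCoeff f k‖ ^ β := by
  classical
  obtain ⟨D, hD⟩ := exists_norm_mFourierCoeff_le hn hμ hp hptop f hO
  have hP1 : 1 ≤ p.toReal := by
    simpa using ENNReal.toReal_mono hptop hp1.out
  have hn0 : (0 : ℝ) < n := by positivity
  have hden : 0 < n * p.toReal + α * p.toReal - n := by nlinarith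
  have hβ0 : 0 < β := lt_of_le_of_lt (by positivity) hβ
  rw [div_lt_iff₀ hden] at hβ
  have hsβ : 1 < (α / n + (1 - 1 / p.toReal)) * β := by
    have h1 : (α / n + (1 - 1 / p.toReal)) * β =
        β * (n * p.toReal + α * p.toReal - n) / (n * p.toReal) := by
      field_simp
      ring
    rw [h1, one_lt_div (by positivity)]
    exact hβ
  -- The zero frequency is set aside: `1 - μ̂(0) = 0` gives no control of `f̂(0)`, but a single term
  -- does not affect summability.
  rw [← Finset.summable_compl_iff {(0 : Fin n → ℤ)}]
  refine summable_rpow_of_exists_le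
    (b := fun k : {k : Fin n → ℤ // k ∉ ({0} : Finset (Fin n → ℤ))} =>
      ‖UnitAddTorus.mFourierCoeff f k‖) (D := D) (fun k => norm_nonneg _) hβ0 hsβ fun S hS => ?_
  obtain ⟨k, hk, hle⟩ := hD (S.map (Function.Embedding.subtype _)) (by simpa using hS) (by simp)
  obtain ⟨k', hk', rfl⟩ := Finset.mem_map.1 hk
  rw [Finset.card_map] at hle
  exact ⟨k', hk', hle⟩

/-! ### Uniform convergence of the Fourier series. -/

/-- An element of `L^p(𝕋ⁿ)` with absolutely summable Fourier coefficients is the uniform sum of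
its Fourier series. -/
theorem exists_continuousMap_of_summable {n : ℕ} {p : ℝ≥0∞} [Fact (1 ≤ p)] (f : LpTorus n p)
    (h : Summable fun k : Fin n → ℤ => ‖UnitAddTorus.mFourierCoeff f k‖) :
    ∃ F : C(UnitAddTorus (Fin n), ℂ), f =ᵐ[torusMeasure n] F ∧
      TendstoUniformly (fun (s : Finset (Fin n → ℤ)) (x : UnitAddTorus (Fin n)) =>
        ∑ k ∈ s, UnitAddTorus.mFourierCoeff f k * UnitAddTorus.mFourier k x) F atTop := by
  let term : (Fin n → ℤ) → C(UnitAddTorus (Fin n), ℂ) := fun k =>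
    UnitAddTorus.mFourierCoeff f k • UnitAddTorus.mFourier k
  have hterm : Summable term := by
    refine Summable.of_norm (h.congr fun k => ?_)
    simp only [term, norm_smul, UnitAddTorus.mFourier_norm, mul_one]
  obtain ⟨F, hF⟩ := hterm
  let φ := ContinuousMap.toLp (E := ℂ) p (torusMeasure n) ℂ
  have hφ : ∀ G : C(UnitAddTorus (Fin n), ℂ), φ G =ᵐ[torusMeasure n] G := fun G =>
    ContinuousMap.coeFn_toLp (torusMeasure n) G
  refine ⟨F, ?_, ?_⟩
  -- Coefficient functionals are continuous on `L^p`, so they pass through the uniformly convergent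
  -- sum; orthonormality leaves one term, and uniqueness of Fourier coefficients gives `f = F`
  -- almost everywhere.
  · have heq : f = φ F := by
      refine eq_of_mFourierCoeff_eq _ _ fun k => ?_
      have h1 : HasSum (fun l => coeffCLM n p k (φ (term l))) (coeffCLM n p k (φ F)) :=
        (hF.mapL φ).mapL (coeffCLM n p k)
      have hkl : ∀ l, coeffCLM n p k (φ (term l)) =
          if l = k then UnitAddTorus.mFourierCoeff f k else 0 := fun l => by
        have h2 : coeffCLM n p k (φ (term l)) = UnitAddTorus.mFourierCoeff f l *
            ∫ x, UnitAddTorus.mFourier l x * starRingEnd ℂ (UnitAddTorus.mFourier k x)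
              ∂torusMeasure n := by
          rw [coeffCLM_apply, mFourierCoeff_eq, ← integral_const_mul]
          refine integral_congr_ae ((hφ (term l)).mono fun x hx => ?_)
          simp only [hx, term, ContinuousMap.smul_apply, smul_eq_mul, UnitAddTorus.mFourier_neg]
          ring
        have h3 := orthonormal_iff_ite.1 (UnitAddTorus.orthonormal_mFourier (d := Fin n)) k l
        rw [ContinuousMap.inner_toLp] at h3
        rw [h2]
        refine (congrArg (UnitAddTorus.mFourierCoeff f l * ·) h3).trans ?_
        by_cases hlk : l = k
        · simp [hlk]
        · simp [hlk, Ne.symm hlk]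
      simp only [hkl] at h1
      exact (hasSum_ite_eq k _).unique h1
    rw [heq]
    exact hφ F
  · have hlim : Tendsto (fun s : Finset (Fin n → ℤ) => ∑ k ∈ s, term k) atTop (𝓝 F) := by
      simpa only [HasSum, SummationFilter.unconditional_filter] using hF
    convert ContinuousMap.tendsto_iff_tendstoUniformly.1 hlim using 3 with s x
    simp [term, ContinuousMap.sum_apply]

end TorusMultiplier

/-! ### The main theorem. -/

theorem mainTheorem10 (n : ℕ) (hn : 2 ≤ n) (σ : ℝ)
    (μ : ComplexMeasure (EuclideanSpace ℝ (Fin n))) (hμ : TorusMultiplier.ClassK σ μ)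
    (p : ℝ≥0∞) [Fact (1 ≤ p)] (hp : p ≤ 2) (f : TorusMultiplier.LpTorus n p) :
    (∀ α β : ℝ, 0 < α → α ≤ 2 * σ →
      (fun t : ℝ => ‖TorusMultiplier.transferredMean
          (ne_top_of_le_ne_top ENNReal.ofNat_ne_top hp) μ t f - f‖)
        =O[𝓝[>] 0] (fun t : ℝ => t ^ α) →
      n * p.toReal / (n * p.toReal + α * p.toReal - n) < β →
      ENNReal.ofReal β ≤ ENNReal.conjExponent p →
      Summable fun k : Fin n → ℤ => ‖UnitAddTorus.mFourierCoeff f k‖ ^ β) ∧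
    (∀ α : ℝ, n / p.toReal < 2 * σ → n / p.toReal < α →
      (fun t : ℝ => ‖TorusMultiplier.transferredMean
          (ne_top_of_le_ne_top ENNReal.ofNat_ne_top hp) μ t f - f‖)
        =O[𝓝[>] 0] (fun t : ℝ => t ^ α) →
      (Summable fun k : Fin n → ℤ => ‖UnitAddTorus.mFourierCoeff f k‖) ∧
      (∀ x : UnitAddTorus (Fin n), Summable fun k : Fin n → ℤ =>
        ‖UnitAddTorus.mFourierCoeff f k * UnitAddTorus.mFourier k x‖) ∧
      ∃ F : C(UnitAddTorus (Fin n), ℂ),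
        f =ᵐ[TorusMultiplier.torusMeasure n] F ∧
        TendstoUniformly
          (fun (s : Finset (Fin n → ℤ)) (x : UnitAddTorus (Fin n)) =>
            ∑ k ∈ s, UnitAddTorus.mFourierCoeff f k * UnitAddTorus.mFourier k x)
          F atTop) := by
  have hn0 : n ≠ 0 := by omega
  have hptop : p ≠ ∞ := ne_top_of_le_ne_top ENNReal.ofNat_ne_top hp
  refine ⟨fun α β hα _ hO hβ _ =>
    TorusMultiplier.summable_norm_mFourierCoeff_rpow hn0 hμ hp hptop f hα hO hβ,
    fun α _ hα hO => ?_⟩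
  have hP : 0 < p.toReal :=
    ENNReal.toReal_pos (zero_lt_one.trans_le (Fact.out : 1 ≤ p)).ne' hptop
  have hn1 : (0 : ℝ) < n := by exact_mod_cast Nat.pos_of_ne_zero hn0
  have hα0 : 0 < α := (div_pos hn1 hP).trans hα
  -- The threshold lies below `1` because `αp > n`, so part (1)'s summability applies with `β = 1`.
  have hβ : n * p.toReal / (n * p.toReal + α * p.toReal - n) < 1 := by
    have h1 : n < α * p.toReal := (div_lt_iff₀ hP).1 hα
    have h2 : 0 < n * p.toReal := mul_pos hn1 hP
    rw [div_lt_one (by linarith)]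
    linarith
  have hsum : Summable fun k : Fin n → ℤ => ‖UnitAddTorus.mFourierCoeff f k‖ := by
    simpa only [Real.rpow_one] using
      TorusMultiplier.summable_norm_mFourierCoeff_rpow hn0 hμ hp hptop f hα0 hO hβ
  refine ⟨hsum, fun x => ?_, TorusMultiplier.exists_continuousMap_of_summable f hsum⟩
  simpa only [norm_mul, TorusMultiplier.norm_mFourier_apply, mul_one] using hsum
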